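/- **Lemma (Laplacian via Poisson brackets).** Let $M$ be a closed Kähler manifold, that is, a compact Hausdorff complex manifold (without boundary) with a smooth Riemannian metric $g$ which is Hermitian, $g(Ju,Jv)=g(u,v)$, where $J$ is the complex structure, and whose fundamental form $\omega(u,v)=g(Ju,v)$ is closed. Let $\pi$ be the Poisson bivector of $(M,\omega)$, that is, the inverse of $\omega$, normalised by $\sum_j\pi^{ij}\omega_{kj}=\delta^i_k$ in local coordinates, and let $$\{f,h\}=\pi(df\wedge dh)=\sum_{i,j}\pi^{ij}\,\partial_i f\,\partial_j h$$ be the associated Poisson bracket of smooth real- or complex-valued functions. Let $X=(X^1,\dots,X^d):M\to\mathbb R^d$ be a smooth isometric embedding, i.e. a smooth embedding with $g_{ij}=\sum_{k=1}^d\partial_iX^k\,\partial_jX^k$. Let $\Delta_g\varphi=-\sum_{i,j}g^{ij}\nabla_i\nabla_j\varphi$ be the Laplace operator of $g$, where $\nabla$ is the Levi-Civita connection. Then, for every smooth function $\varphi$ on $M$ with values in $\mathbb R$ or $\mathbb C$, $$\Delta_g\varphi=-\sum_{k=1}^d\{X^k,\{X^k,\varphi\}\}.$$ -/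

import Mathlib

open scoped Manifold ContDiff Bundle

noncomputable section

namespace KahlerLaplacian

section RealStructure

variable {E : Type*} [NormedAddCommGroup E] [NormedSpace ℂ E]
  {M : Type*} [TopologicalSpace M] [ChartedSpace E M]

/-- A complex manifold, viewed with the same charts, is a real-analytic (in particular smooth)
manifold modelled on the underlying real vector space. -/
instance isManifold_real [IsManifold 𝓘(ℂ, E) ω M] : IsManifold 𝓘(ℝ, E) ω M := by
  refine isManifold_of_contDiffOn _ _ _ fun e e' he he' => ?_
  have h := (mem_groupoid_of_pregroupoid.1
    (HasGroupoid.compatible (G := contDiffGroupoid ω 𝓘(ℂ, E)) he he')).1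
  have h' : ContDiffOn ℂ ω (𝓘(ℂ, E) ∘ (e.symm ≫ₕ e') ∘ 𝓘(ℂ, E).symm)
    (𝓘(ℂ, E).symm ⁻¹' (e.symm ≫ₕ e').source ∩ Set.range 𝓘(ℂ, E)) := h
  exact h'.restrict_scalars ℝ

end RealStructure

section Defs

variable {E : Type*} [NormedAddCommGroup E] [NormedSpace ℂ E]
  {M : Type*} [TopologicalSpace M] [ChartedSpace E M]

/-- The almost complex structure `J` of a complex manifold: multiplication by `i` on each tangent
space. The tangent space at `x` is identified with the complex vector space `E` by a holomorphic
chart around `x`, and changes of holomorphic charts have complex linear differentials. -/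
def tangentJ (x : M) : TangentSpace 𝓘(ℝ, E) x →L[ℝ] TangentSpace 𝓘(ℝ, E) x :=
  ((Complex.I • ContinuousLinearMap.id ℂ E).restrictScalars ℝ : E →L[ℝ] E)

/-- The expression, in the chart around `x₀`, of a field `B` of bilinear forms on the tangent
spaces of `M`: the pullback of `B` by the inverse of the chart, a function of a point `y` in the
target of the chart. -/
def inChart
    (B : ∀ x : M, TangentSpace 𝓘(ℝ, E) x →L[ℝ] TangentSpace 𝓘(ℝ, E) x →L[ℝ] ℝ)
    (x₀ : M) (y : E) : E →L[ℝ] E →L[ℝ] ℝ :=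
  let p : M := (extChartAt 𝓘(ℝ, E) x₀).symm y
  let D : E →L[ℝ] E := mfderiv 𝓘(ℝ, E) 𝓘(ℝ, E) (extChartAt 𝓘(ℝ, E) x₀).symm y
  (B p : E →L[ℝ] E →L[ℝ] ℝ).bilinearComp D D

variable [IsManifold 𝓘(ℂ, E) ω M]

/-- Smooth Riemannian metrics on (the smooth manifold underlying) a complex manifold. -/
abbrev Metric (E : Type*) [NormedAddCommGroup E] [NormedSpace ℂ E]
    (M : Type*) [TopologicalSpace M] [ChartedSpace E M] [IsManifold 𝓘(ℂ, E) ω M] :=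
  Bundle.ContMDiffRiemannianMetric 𝓘(ℝ, E) ∞ E (fun x : M => TangentSpace 𝓘(ℝ, E) x)

/-- The fundamental form `ω(u, v) = g(J u, v)`. -/
def fundamentalForm (g : Metric E M) (x : M) :
    TangentSpace 𝓘(ℝ, E) x →L[ℝ] TangentSpace 𝓘(ℝ, E) x →L[ℝ] ℝ :=
  (g.inner x).comp (tangentJ x)

/-- The metric `g` on the complex manifold `M` is Kähler: it is Hermitian, and its fundamental
form is closed. The exterior derivative of `ω` at `x` is computed in the chart around `x`, as
`dω(u, v, w) = ∂_u ω(v, w) + ∂_v ω(w, u) + ∂_w ω(u, v)` for constant `u`, `v`, `w`. -/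
structure IsKahler (g : Metric E M) : Prop where
  hermitian : ∀ (x : M) (u v : TangentSpace 𝓘(ℝ, E) x),
    g.inner x (tangentJ x u) (tangentJ x v) = g.inner x u v
  closed : ∀ (x : M) (u v w : E),
    fderiv ℝ (fun y => inChart (fundamentalForm g) x y v w) (extChartAt 𝓘(ℝ, E) x x) u +
    fderiv ℝ (fun y => inChart (fundamentalForm g) x y w u) (extChartAt 𝓘(ℝ, E) x x) v +
    fderiv ℝ (fun y => inChart (fundamentalForm g) x y u v) (extChartAt 𝓘(ℝ, E) x x) w = 0

/-- `X : M → ℝ^d` is an isometric embedding: a smooth topological embedding whose induced metric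
is `g` (its differentials are then automatically injective). -/
structure IsIsometricEmbedding (g : Metric E M) {d : ℕ} (X : M → EuclideanSpace ℝ (Fin d)) :
    Prop where
  smooth : ContMDiff 𝓘(ℝ, E) 𝓘(ℝ, EuclideanSpace ℝ (Fin d)) ∞ X
  embedding : Topology.IsEmbedding X
  isometric : ∀ (x : M) (u v : TangentSpace 𝓘(ℝ, E) x),
    inner ℝ (mvfderiv 𝓘(ℝ, E) X x u) (mvfderiv 𝓘(ℝ, E) X x v) = g.inner x u v

variable [FiniteDimensional ℂ E]

/-- A basis of the real vector space `E`. It gives the linear coordinates `(y^i)` in which tensors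
are written below; nothing that is defined from them depends on the choice. -/
def coordBasis (E : Type*) [NormedAddCommGroup E] [NormedSpace ℂ E] [FiniteDimensional ℂ E] :
    Module.Basis (Fin (Module.finrank ℝ E)) ℝ E :=
  Module.finBasis ℝ E

/-- The components `π^{ij}` of the Poisson bivector of the Kähler manifold at `x`: the bivector
inverse to the fundamental form, normalised by `∑ j, π^{ij} ω_{kj} = δ^i_k`. -/
def poissonBivector (g : Metric E M) (x : M) :
    Matrix (Fin (Module.finrank ℝ E)) (Fin (Module.finrank ℝ E)) ℝ :=
  (Matrix.of fun k j : Fin (Module.finrank ℝ E) =>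
    fundamentalForm g x (coordBasis E k : E) (coordBasis E j : E))⁻¹.transpose

variable {𝕜 : Type*} [RCLike 𝕜]

/-- The partial derivative `∂_i f` at `x`, for a real- or complex-valued function `f` on `M`. -/
def partialDeriv (f : M → 𝕜) (x : M) (i : Fin (Module.finrank ℝ E)) : 𝕜 :=
  mvfderiv 𝓘(ℝ, E) f x (coordBasis E i : E)

/-- The Poisson bracket `{f, h} = π(df ∧ dh) = ∑ i j, π^{ij} ∂_i f ∂_j h`. -/
def poissonBracket (g : Metric E M) (f h : M → 𝕜) (x : M) : 𝕜 :=
  ∑ i, ∑ j, poissonBivector g x i j •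
    (partialDeriv (E := E) f x i * partialDeriv (E := E) h x j)

/-- The matrix `g_{ij}` of the metric in the chart around `x`, at the point `y` of its target. -/
def metricMatrix (g : Metric E M) (x : M) (y : E) :
    Matrix (Fin (Module.finrank ℝ E)) (Fin (Module.finrank ℝ E)) ℝ :=
  Matrix.of fun i j => inChart g.inner x y (coordBasis E i) (coordBasis E j)

/-- The Christoffel symbol `Γ^k_{ij}` of the Levi-Civita connection of `g` in the chart around `x`,
at the point `y` of its target. -/
def christoffel (g : Metric E M) (x : M) (y : E) (k i j : Fin (Module.finrank ℝ E)) : ℝ :=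
  (1 / 2) * ∑ l, (metricMatrix g x y)⁻¹ k l *
    (fderiv ℝ (fun z => metricMatrix g x z j l) y (coordBasis E i) +
      fderiv ℝ (fun z => metricMatrix g x z i l) y (coordBasis E j) -
      fderiv ℝ (fun z => metricMatrix g x z i j) y (coordBasis E l))

/-- The components `∇_i ∇_j φ = ∂_i ∂_j φ - Γ^k_{ij} ∂_k φ` at `x` of the second covariant
derivative of `φ`, in the chart around `x`. -/
def hessian (g : Metric E M) (φ : M → 𝕜) (x : M) (i j : Fin (Module.finrank ℝ E)) : 𝕜 :=
  let φc : E → 𝕜 := fun y => φ ((extChartAt 𝓘(ℝ, E) x).symm y)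
  let y₀ : E := extChartAt 𝓘(ℝ, E) x x
  fderiv ℝ (fun y => fderiv ℝ φc y (coordBasis E j)) y₀ (coordBasis E i) -
    ∑ k, christoffel g x y₀ k i j • fderiv ℝ φc y₀ (coordBasis E k)

/-- The (Bochner-)Laplace operator `Δ_g φ = -g^{ij} ∇_i ∇_j φ`. -/
def laplacian (g : Metric E M) (φ : M → 𝕜) (x : M) : 𝕜 :=
  -∑ i, ∑ j, (metricMatrix g x (extChartAt 𝓘(ℝ, E) x x))⁻¹ i j • hessian g φ x i j

end Defs

end KahlerLaplacian

end

/-! Work in a holomorphic chart around `x`, where `J` is the constant map `mulI`. Let `ξ k` be the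
components of `X`, `n k` their gradients, and `Φ` the function `φ` read in the chart. Isometry says
that `g = ∑ k, dξ k ⊗ dξ k`, so the `n k` form a Parseval frame (`sum_smul_gradient_eq`): `g⁻¹ = ∑
k, n k ⊗ n k`, and traces can be taken over the redundant frame `n k`.

Inverting the fundamental form in this frame gives `{X k, h} = dh (J (n k))`
(`poissonBracket_component`). Hence `∑ k, {X k, {X k, φ}}` is `∑ k, D²Φ (J (n k), J (n k))` plus the
first-order term `DΦ (J (∑ k, D(n k) (J (n k))))`. For a Hermitian metric that vector sum vanishes
(`sum_derivative_gradient_eq_zero`), and `J` drops out of the trace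
(`sum_apply_gradient_invariant`), leaving `∑ k, D²Φ (n k, n k) = g^{ij} ∂_i ∂_j Φ`.

Closedness of the fundamental form enters on the Laplacian side: it gives `g^{ij} Γ^l_{ij} = 0` in
holomorphic coordinates (`sum_metricMatrix_inv_mul_christoffel`), so `Δφ` is minus the same trace
(`laplacian_eq_sum`). -/

noncomputable section

namespace KahlerLaplacian

open Filter Topology

/-! ### Linear algebra of gradient frames at one point. -/

section GradientFrame

variable {V : Type*} [AddCommGroup V] [Module ℝ V] {ι : Type*} [Fintype ι]
  {a : ι → V →ₗ[ℝ] ℝ} {n : ι → V} {J : V →ₗ[ℝ] V}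

/-- If the covectors `a k` separate points and `n k` is the gradient of `a k` for the scalar
product `∑ k, a k ⊗ a k`, then the vectors `n k` form a Parseval frame. -/
theorem sum_smul_gradient_eq (ha : ∀ v, (∀ k, a k v = 0) → v = 0)
    (hn : ∀ k v, ∑ m, a m (n k) * a m v = a k v) (v : V) : ∑ k, a k v • n k = v := by
  rw [← sub_eq_zero]
  -- The difference is orthogonal to every `w`; pairing it with itself then gives a vanishing sum of
  -- squares.
  have key : ∀ w, ∑ m, a m (∑ k, a k v • n k - v) * a m w = 0 := fun w => by
    simp only [map_sub, map_sum, map_smul, smul_eq_mul, sub_mul, Finset.sum_sub_distrib,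
      Finset.sum_mul]
    rw [Finset.sum_comm, sub_eq_zero]
    exact Finset.sum_congr rfl fun k _ => by
      rw [← hn k w, Finset.mul_sum]
      exact Finset.sum_congr rfl fun m _ => by ring
  refine ha _ fun k => ?_
  have h := key (∑ k, a k v • n k - v)
  rw [Finset.sum_eq_zero_iff_of_nonneg fun i _ => mul_self_nonneg _] at h
  exact mul_self_eq_zero.1 (h k (Finset.mem_univ _))

/-- For a skew-adjoint `J`, the matrix of `J` in the gradient frame is antisymmetric. -/
theorem apply_gradient_antisymm (hn : ∀ k v, ∑ m, a m (n k) * a m v = a k v)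
    (hJ : ∀ u v, ∑ m, a m (J u) * a m v = -∑ m, a m u * a m (J v)) (k l : ι) :
    a k (J (n l)) = -a l (J (n k)) := by
  have h := hJ (n l) (n k)
  rw [hn l] at h
  rw [← hn k, ← neg_eq_iff_eq_neg.2 h.symm.symm, neg_neg]
  exact Finset.sum_congr rfl fun _ _ => mul_comm _ _

/-- The trace of a bilinear map over the gradient frame changes sign when a skew-adjoint `J` is
moved from one argument to the other. -/
theorem sum_apply_gradient_skew {W : Type*} [AddCommGroup W] [Module ℝ W]
    (hpar : ∀ v, ∑ k, a k v • n k = v) (hn : ∀ k v, ∑ m, a m (n k) * a m v = a k v)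
    (hJ : ∀ u v, ∑ m, a m (J u) * a m v = -∑ m, a m u * a m (J v)) (B : V →ₗ[ℝ] V →ₗ[ℝ] W) :
    ∑ k, B (J (n k)) (n k) = -∑ k, B (n k) (J (n k)) := by
  -- Both traces are expanded with the matrix `a m (J (n k))`; exchanging the two indices costs the
  -- sign of its antisymmetry.
  have h1 : ∑ k, B (J (n k)) (n k) = ∑ k, ∑ m, a m (J (n k)) • B (n m) (n k) :=
    Finset.sum_congr rfl fun k _ => by
      conv_lhs => rw [← hpar (J (n k))]
      simp
  have h2 : ∑ k, B (n k) (J (n k)) = ∑ k, ∑ m, a m (J (n k)) • B (n k) (n m) :=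
    Finset.sum_congr rfl fun k _ => by
      conv_lhs => rw [← hpar (J (n k))]
      simp
  rw [h1, h2, Finset.sum_comm, ← Finset.sum_neg_distrib]
  refine Finset.sum_congr rfl fun k _ => ?_
  rw [← Finset.sum_neg_distrib]
  exact Finset.sum_congr rfl fun m _ => by rw [apply_gradient_antisymm hn hJ k m, neg_smul]

/-- The trace of a bilinear map over the gradient frame is invariant under `J`. -/
theorem sum_apply_gradient_invariant {W : Type*} [AddCommGroup W] [Module ℝ W]
    (hpar : ∀ v, ∑ k, a k v • n k = v) (hn : ∀ k v, ∑ m, a m (n k) * a m v = a k v)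
    (hJ : ∀ u v, ∑ m, a m (J u) * a m v = -∑ m, a m u * a m (J v)) (hJJ : ∀ v, J (J v) = -v)
    (B : V →ₗ[ℝ] V →ₗ[ℝ] W) :
    ∑ k, B (J (n k)) (J (n k)) = ∑ k, B (n k) (n k) := by
  simpa [hJJ] using sum_apply_gradient_skew hpar hn hJ (B.compl₂ J)

variable {T : V →ₗ[ℝ] V →ₗ[ℝ] V →ₗ[ℝ] ℝ} {b : ι → V →ₗ[ℝ] V →ₗ[ℝ] ℝ}

/-- Let `T w` be the derivative along `w` of the metric `∑ k, a k ⊗ a k`, where `b k` is the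
derivative of `a k`. If the fundamental form is closed, the metric trace of the Christoffel symbols
of the first kind vanishes. -/
theorem sum_christoffel_gradient_eq_zero
    (hpar : ∀ v, ∑ k, a k v • n k = v) (hn : ∀ k v, ∑ m, a m (n k) * a m v = a k v)
    (hJ : ∀ u v, ∑ m, a m (J u) * a m v = -∑ m, a m u * a m (J v)) (hJJ : ∀ v, J (J v) = -v)
    (hsymm : ∀ w u v, T w u v = T w v u)
    (hTJ : ∀ w u v, T w (J u) v = -T w u (J v))
    (hclosed : ∀ u v w, T u (J v) w + T v (J w) u + T w (J u) v = 0) (u : V) :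
    ∑ k, (T (n k) (n k) u + T (n k) (n k) u - T u (n k) (n k)) = 0 := by
  have h1 := sum_apply_gradient_invariant hpar hn hJ hJJ (T.compr₂ (LinearMap.applyₗ u))
  have h2 := sum_apply_gradient_invariant hpar hn hJ hJJ (T u)
  simp only [LinearMap.compr₂_apply, LinearMap.applyₗ_apply_apply] at h1
  -- Closedness on the triple `u, n k, J (n k)`. After summation, `J`-invariance merges the last two
  -- terms into twice the trace of `T (n k) (n k) u`.
  have h3 : ∀ k, T u (n k) (n k) - T (n k) (n k) u - T (J (n k)) (J (n k)) u = 0 := fun k => by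
    have h := hclosed u (n k) (J (n k))
    rw [hJJ, hTJ u (n k) (J (n k)), hJJ, hTJ (J (n k)) u (n k), hsymm _ u] at h
    simp only [map_neg, LinearMap.neg_apply, neg_neg] at h
    linarith
  have h4 := Finset.sum_congr rfl fun k (_ : k ∈ Finset.univ) => h3 k
  simp only [Finset.sum_sub_distrib, Finset.sum_add_distrib, Finset.sum_const_zero] at h4 ⊢
  linarith

/-- With the notation of `sum_christoffel_gradient_eq_zero`, let `N k` be the derivative of the
gradient `n k`. For a Hermitian metric, the sum of the derivatives of `n k` along `J (n k)`
vanishes. -/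
theorem sum_derivative_gradient_eq_zero
    (ha : ∀ v, (∀ k, a k v = 0) → v = 0) (hn : ∀ k v, ∑ m, a m (n k) * a m v = a k v)
    (hJ : ∀ u v, ∑ m, a m (J u) * a m v = -∑ m, a m u * a m (J v))
    (hT : ∀ w u v, T w u v = ∑ k, (b k w u * a k v + a k u * b k w v))
    (hb : ∀ k u v, b k u v = b k v u)
    (hTJ : ∀ w u v, T w (J u) v = -T w u (J v)) {N : ι → V →ₗ[ℝ] V}
    (hN : ∀ k w v, T w (n k) v + ∑ m, a m (N k w) * a m v = b k w v) :
    ∑ k, N k (J (n k)) = 0 := by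
  have hpar := sum_smul_gradient_eq ha hn
  have hsymm : ∀ w u v, T w u v = T w v u := fun w u v => by
    rw [hT, hT]
    exact Finset.sum_congr rfl fun k _ => by ring
  have hzero : ∀ v, ∑ m, a m (∑ k, N k (J (n k))) * a m v = 0 := fun v => by
    have h1 : ∑ m, a m (∑ k, N k (J (n k))) * a m v =
        ∑ k, b k (J (n k)) v - ∑ k, T (J (n k)) (n k) v := by
      rw [← Finset.sum_sub_distrib]
      simp only [map_sum, Finset.sum_mul]
      rw [Finset.sum_comm]
      exact Finset.sum_congr rfl fun k _ => by rw [← hN]; ring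
    -- Expand `n m` in the frame and use the symmetry `a k (n m) = a m (n k)`; this produces the
    -- contraction handled by `h3`.
    have h2 : ∑ k, b k (J (n k)) v = ∑ k, ∑ m, a m (n k) * b m (J (n k)) v := by
      rw [Finset.sum_comm]
      refine Finset.sum_congr rfl fun m _ => ?_
      conv_lhs => rw [← hpar (n m)]
      simp only [map_sum, map_smul, LinearMap.sum_apply, LinearMap.smul_apply, smul_eq_mul]
      exact Finset.sum_congr rfl fun k _ => by
        rw [← hn m (n k), ← hn k (n m)]
        simp only [mul_comm]
    -- Koszul's formula: for an induced metric, the Christoffel symbols of the first kind are `∑ m,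
    -- a m ⊗ b m`.
    have h3 : ∀ u w, ∑ m, a m u * b m w v = (T w u v + T v u w - T u w v) / 2 := fun u w => by
      rw [hT, hT, hT, ← Finset.sum_add_distrib, ← Finset.sum_sub_distrib, Finset.sum_div]
      exact Finset.sum_congr rfl fun k _ => by
        rw [hb k v u, hb k v w, hb k w u]; ring
    have h4 := sum_apply_gradient_skew hpar hn hJ (T.compr₂ (LinearMap.applyₗ v))
    simp only [LinearMap.compr₂_apply, LinearMap.applyₗ_apply_apply] at h4
    -- `T v` is symmetric and `J` is skew for it, so the middle Koszul term vanishes. By `h4` the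
    -- other two add up to the trace of `T (J (n k)) (n k) v`, which cancels the one subtracted in
    -- `h1`.
    have h5 : ∀ k, T v (n k) (J (n k)) = 0 := fun k => by
      have := hTJ v (n k) (n k)
      rw [hsymm] at this
      linarith
    simp only [h1, h2, h3, h5, add_zero, ← Finset.sum_div, Finset.sum_sub_distrib]
    linarith
  refine ha _ fun k => ?_
  have h := hzero (∑ k, N k (J (n k)))
  rw [Finset.sum_eq_zero_iff_of_nonneg fun i _ => mul_self_nonneg _] at h
  exact mul_self_eq_zero.1 (h k (Finset.mem_univ _))

end GradientFrame

/-! ### Induced metrics and gradients on an open piece of a vector space. -/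

section Chart

variable {E : Type*} [NormedAddCommGroup E] [NormedSpace ℝ E] {ι : Type*} [Fintype ι]

/-- The metric `∑ k, dξ k ⊗ dξ k` induced by the functions `ξ k`. -/
def gram (ξ : ι → E → ℝ) (y : E) : E →L[ℝ] E →L[ℝ] ℝ :=
  ∑ k, (fderiv ℝ (ξ k) y).smulRight (fderiv ℝ (ξ k) y)

/-- The gradient of `ξ k` for the metric `gram ξ`. -/
def gramGradient (ξ : ι → E → ℝ) (k : ι) (y : E) : E :=
  (gram ξ y).inverse (fderiv ℝ (ξ k) y)

theorem gram_apply (ξ : ι → E → ℝ) (y u v : E) :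
    gram ξ y u v = ∑ k, fderiv ℝ (ξ k) y u * fderiv ℝ (ξ k) y v := by
  simp [gram]

variable {ξ : ι → E → ℝ} {y : E}

theorem contDiffAt_gram (hξ : ∀ k, ContDiffAt ℝ ∞ (ξ k) y) : ContDiffAt ℝ ∞ (gram ξ) y := by
  have h : ∀ k, ContDiffAt ℝ ∞ (fderiv ℝ (ξ k)) y := fun k =>
    (hξ k).fderiv_right (by simp)
  exact ContDiffAt.sum fun k _ => (h k).smulRight (h k)

/-- The derivative of the metric `gram ξ`, as a trilinear form. -/
def gramDeriv (ξ : ι → E → ℝ) (y : E) : E →ₗ[ℝ] E →ₗ[ℝ] E →ₗ[ℝ] ℝ :=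
  (fderiv ℝ (gram ξ) y).toLinearMap₁₂.compr₂ (ContinuousLinearMap.coeLM ℝ)

theorem fderiv_gram_apply (hξ : ∀ k, ContDiffAt ℝ ∞ (ξ k) y) (u v w : E) :
    fderiv ℝ (fun z => gram ξ z u v) y w = gramDeriv ξ y w u v := by
  have h := (contDiffAt_gram hξ).differentiableAt (by simp)
  rw [fderiv_clm_apply (h.clm_apply (differentiableAt_const _)) (differentiableAt_const _),
    fderiv_clm_apply h (differentiableAt_const _)]
  simp [gramDeriv]

theorem gramDeriv_apply (hξ : ∀ k, ContDiffAt ℝ ∞ (ξ k) y) (w u v : E) :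
    gramDeriv ξ y w u v = ∑ k, (fderiv ℝ (fderiv ℝ (ξ k)) y w u * fderiv ℝ (ξ k) y v +
      fderiv ℝ (ξ k) y u * fderiv ℝ (fderiv ℝ (ξ k)) y w v) := by
  have h : ∀ k, DifferentiableAt ℝ (fderiv ℝ (ξ k)) y := fun k =>
    ((hξ k).fderiv_right (m := ∞) (by simp)).differentiableAt (by simp)
  have h' : ∀ k z, DifferentiableAt ℝ (fun y => fderiv ℝ (ξ k) y z) y := fun k z =>
    (h k).clm_apply (differentiableAt_const _)
  rw [← fderiv_gram_apply hξ]
  simp only [gram_apply]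
  rw [fderiv_fun_sum fun k _ => (h' k u).fun_mul (h' k v)]
  simp only [_root_.sum_apply]
  refine Finset.sum_congr rfl fun k _ => ?_
  rw [fderiv_fun_mul (h' k u) (h' k v), fderiv_clm_apply (h k) (differentiableAt_const _),
    fderiv_clm_apply (h k) (differentiableAt_const _)]
  simp
  ring

variable {J : E →L[ℝ] E}

/-- `J` does not depend on the point, so its skewness, known near `y`, can be differentiated. -/
theorem gramDeriv_skew (hξ : ∀ k, ContDiffAt ℝ ∞ (ξ k) y)
    (hJ : ∀ᶠ z in 𝓝 y, ∀ u v, gram ξ z (J u) v = -gram ξ z u (J v)) (w u v : E) :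
    gramDeriv ξ y w (J u) v = -gramDeriv ξ y w u (J v) := by
  have h : (fun z => gram ξ z (J u) v) =ᶠ[𝓝 y] fun z => -gram ξ z u (J v) :=
    hJ.mono fun z hz => hz u v
  rw [← fderiv_gram_apply hξ, ← fderiv_gram_apply hξ, h.fderiv_eq, fderiv_fun_neg]
  rfl

variable [FiniteDimensional ℝ E]

/-- Positive definiteness gives injectivity into the dual, which has the same dimension. -/
theorem gram_isInvertible (h : ∀ v, (∀ k, fderiv ℝ (ξ k) y v = 0) → v = 0) :
    (gram ξ y).IsInvertible := by
  have hinj : Function.Injective (gram ξ y) := by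
    rw [injective_iff_map_eq_zero]
    intro v hv
    refine h v fun k => ?_
    have h' : gram ξ y v v = 0 := by rw [hv]; rfl
    rw [gram_apply, Finset.sum_eq_zero_iff_of_nonneg fun i _ => mul_self_nonneg _] at h'
    exact mul_self_eq_zero.1 (h' k (Finset.mem_univ _))
  have hrank : Module.finrank ℝ E = Module.finrank ℝ (E →L[ℝ] ℝ) := by
    rw [← (LinearMap.toContinuousLinearMap (𝕜 := ℝ) (E := E) (F' := ℝ)).finrank_eq]
    exact Subspace.dual_finrank_eq.symm
  exact ⟨(LinearEquiv.ofInjectiveOfFinrankEq (gram ξ y : E →ₗ[ℝ] E →L[ℝ] ℝ) hinj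
    hrank).toContinuousLinearEquiv, by ext; rfl⟩

theorem gram_gramGradient (h : ∀ v, (∀ k, fderiv ℝ (ξ k) y v = 0) → v = 0) (k : ι) :
    gram ξ y (gramGradient ξ k y) = fderiv ℝ (ξ k) y :=
  (gram_isInvertible h).self_apply_inverse _

theorem differentiableAt_gramGradient (hξ : ∀ k, ContDiffAt ℝ ∞ (ξ k) y)
    (h : ∀ v, (∀ k, fderiv ℝ (ξ k) y v = 0) → v = 0) (k : ι) :
    DifferentiableAt ℝ (gramGradient ξ k) y := by
  obtain ⟨e, he⟩ := gram_isInvertible h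
  have h1 : ContDiffAt ℝ ∞ (fun z => (gram ξ z).inverse) y := by
    have := contDiffAt_map_inverse (𝕜 := ℝ) (n := ∞) e
    rw [he] at this
    exact this.comp y (contDiffAt_gram hξ)
  exact (h1.differentiableAt (by simp)).clm_apply
    (((hξ k).fderiv_right (m := ∞) (by simp)).differentiableAt (by simp))

theorem sum_fderiv_gramGradient_eq_zero (hξ : ∀ k, ContDiffAt ℝ ∞ (ξ k) y)
    (hinj : ∀ᶠ z in 𝓝 y, ∀ v, (∀ k, fderiv ℝ (ξ k) z v = 0) → v = 0)
    (hJ : ∀ᶠ z in 𝓝 y, ∀ u v, gram ξ z (J u) v = -gram ξ z u (J v)) :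
    ∑ k, fderiv ℝ (gramGradient ξ k) y (J (gramGradient ξ k y)) = 0 := by
  refine sum_derivative_gradient_eq_zero (a := fun k => (fderiv ℝ (ξ k) y : E →ₗ[ℝ] ℝ))
    (n := fun k => gramGradient ξ k y) (J := (J : E →ₗ[ℝ] E)) (T := gramDeriv ξ y)
    (b := fun k => (fderiv ℝ (fderiv ℝ (ξ k)) y).toLinearMap₁₂)
    (N := fun k => (fderiv ℝ (gramGradient ξ k) y : E →ₗ[ℝ] E)) hinj.self_of_nhds
    (fun k v => ?_) (fun u v => ?_) (gramDeriv_apply hξ) (fun k u v => ?_)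
    (gramDeriv_skew hξ hJ) (fun k w v => ?_)
  · simpa [gram_apply] using congr($(gram_gramGradient hinj.self_of_nhds k) v)
  · simpa [gram_apply] using hJ.self_of_nhds u v
  · have h2 : ((2 : ℕ∞) : WithTop ℕ∞) ≤ ∞ := WithTop.coe_le_coe.2 le_top
    exact ((hξ k).isSymmSndFDerivAt (by simpa using h2)) u v
  -- Differentiating the equation that defines the gradient relates its derivative to the Hessian of
  -- `ξ k`; the equation must hold near `y`, not only at `y`.
  · have h1 : (fun z => gram ξ z (gramGradient ξ k z)) =ᶠ[𝓝 y] fderiv ℝ (ξ k) :=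
      hinj.mono fun z hz => gram_gramGradient hz k
    have h2 := congr($(h1.fderiv_eq (𝕜 := ℝ)) w v)
    rw [fderiv_clm_apply ((contDiffAt_gram hξ).differentiableAt (by simp))
      (differentiableAt_gramGradient hξ hinj.self_of_nhds k)] at h2
    simpa [gramDeriv, gram_apply, add_comm] using h2

theorem sum_christoffel_gramGradient_eq_zero (hξ : ∀ k, ContDiffAt ℝ ∞ (ξ k) y)
    (hinj : ∀ v, (∀ k, fderiv ℝ (ξ k) y v = 0) → v = 0) (hJJ : ∀ v, J (J v) = -v)
    (hJ : ∀ᶠ z in 𝓝 y, ∀ u v, gram ξ z (J u) v = -gram ξ z u (J v))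
    (hclosed : ∀ u v w, gramDeriv ξ y u (J v) w + gramDeriv ξ y v (J w) u +
      gramDeriv ξ y w (J u) v = 0) (u : E) :
    ∑ k, (gramDeriv ξ y (gramGradient ξ k y) (gramGradient ξ k y) u +
      gramDeriv ξ y (gramGradient ξ k y) (gramGradient ξ k y) u -
      gramDeriv ξ y u (gramGradient ξ k y) (gramGradient ξ k y)) = 0 := by
  have hn : ∀ k v, ∑ m, fderiv ℝ (ξ m) y (gramGradient ξ k y) * fderiv ℝ (ξ m) y v =
      fderiv ℝ (ξ k) y v := fun k v => by
    simpa [gram_apply] using congr($(gram_gramGradient hinj k) v)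
  refine sum_christoffel_gradient_eq_zero (a := fun k => (fderiv ℝ (ξ k) y : E →ₗ[ℝ] ℝ))
    (n := fun k => gramGradient ξ k y) (J := (J : E →ₗ[ℝ] E)) (T := gramDeriv ξ y)
    (sum_smul_gradient_eq hinj hn) hn (fun u v => ?_) hJJ (fun w u v => ?_)
    (gramDeriv_skew hξ hJ) hclosed u
  · simpa [gram_apply] using hJ.self_of_nhds u v
  · rw [gramDeriv_apply hξ, gramDeriv_apply hξ]
    exact Finset.sum_congr rfl fun k _ => by ring

/-- The sum of the iterated derivatives of `Φ` along the Hamiltonian fields `J (grad ξ k)` is the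
trace of the second derivative of `Φ`. -/
theorem sum_fderiv_fderiv_gramGradient {F : Type*} [NormedAddCommGroup F] [NormedSpace ℝ F]
    {Φ : E → F} (hΦ : ContDiffAt ℝ ∞ Φ y) (hξ : ∀ k, ContDiffAt ℝ ∞ (ξ k) y)
    (hinj : ∀ᶠ z in 𝓝 y, ∀ v, (∀ k, fderiv ℝ (ξ k) z v = 0) → v = 0)
    (hJJ : ∀ v, J (J v) = -v)
    (hJ : ∀ᶠ z in 𝓝 y, ∀ u v, gram ξ z (J u) v = -gram ξ z u (J v)) :
    ∑ k, fderiv ℝ (fun z => fderiv ℝ Φ z (J (gramGradient ξ k z))) y (J (gramGradient ξ k y)) =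
      ∑ k, fderiv ℝ (fderiv ℝ Φ) y (gramGradient ξ k y) (gramGradient ξ k y) := by
  have hn : ∀ k v, ∑ m, fderiv ℝ (ξ m) y (gramGradient ξ k y) * fderiv ℝ (ξ m) y v =
      fderiv ℝ (ξ k) y v := fun k v => by
    simpa [gram_apply] using congr($(gram_gramGradient hinj.self_of_nhds k) v)
  have h1 := sum_apply_gradient_invariant (a := fun k => (fderiv ℝ (ξ k) y : E →ₗ[ℝ] ℝ))
    (n := fun k => gramGradient ξ k y) (J := (J : E →ₗ[ℝ] E))
    (sum_smul_gradient_eq hinj.self_of_nhds hn) hn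
    (fun u v => by simpa [gram_apply] using hJ.self_of_nhds u v) hJJ
    (fderiv ℝ (fderiv ℝ Φ) y).toLinearMap₁₂
  have hd : ∀ k, DifferentiableAt ℝ (gramGradient ξ k) y := fun k =>
    differentiableAt_gramGradient hξ hinj.self_of_nhds k
  have h2 : ∀ k, fderiv ℝ (fun z => fderiv ℝ Φ z (J (gramGradient ξ k z))) y
      (J (gramGradient ξ k y)) =
      fderiv ℝ (fderiv ℝ Φ) y (J (gramGradient ξ k y)) (J (gramGradient ξ k y)) +
      fderiv ℝ Φ y (J (fderiv ℝ (gramGradient ξ k) y (J (gramGradient ξ k y)))) := fun k => by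
    have hJd : HasFDerivAt (fun z => J (gramGradient ξ k z))
      (J.comp (fderiv ℝ (gramGradient ξ k) y)) y := J.hasFDerivAt.comp y (hd k).hasFDerivAt
    rw [fderiv_clm_apply ((hΦ.fderiv_right (m := ∞) (by simp)).differentiableAt (by simp))
      hJd.differentiableAt, hJd.fderiv]
    simp [add_comm]
  -- Only the sum over `k` of the first-order terms vanishes, so it is first pulled inside the
  -- linear maps `J` and `fderiv ℝ Φ y`.
  simp only [h2, Finset.sum_add_distrib, ← map_sum,
    sum_fderiv_gramGradient_eq_zero hξ hinj hJ, map_zero, add_zero]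
  exact h1

end Chart

/-! ### From tensor components in a basis to sums over a frame. -/

section Components

variable {V W ι κ : Type*} [AddCommGroup V] [Module ℝ V] [AddCommGroup W] [Module ℝ W]
  [Fintype ι] [Fintype κ]

/-- The inverse of the Gram matrix of a bilinear form, from a frame reproducing vectors. -/
theorem gramMatrix_inv_eq [DecidableEq κ] (b : Module.Basis κ ℝ V) (B : V →ₗ[ℝ] V →ₗ[ℝ] ℝ)
    {m m' : ι → V}
    (h : ∀ v, ∑ k, B v (m k) • m' k = v) :
    (Matrix.of fun i j => B (b i) (b j))⁻¹ =
      Matrix.of fun i j => ∑ k, b.repr (m k) i * b.repr (m' k) j := by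
  refine Matrix.inv_eq_right_inv ?_
  ext i j
  have h1 : ∀ k, ∑ l, B (b i) (b l) * b.repr (m k) l = B (b i) (m k) := fun k => by
    conv_rhs => rw [← b.sum_repr (m k)]
    simp [-Module.Basis.sum_repr, mul_comm]
  have h2 := congr(b.repr $(h (b i)) j)
  simp only [map_sum, map_smul, Finsupp.coe_finsetSum, Finset.sum_apply, Finsupp.smul_apply,
    smul_eq_mul, Module.Basis.repr_self] at h2
  simp only [Matrix.mul_apply, Matrix.of_apply, Finset.mul_sum]
  rw [Finset.sum_comm, Matrix.one_apply, ← Finsupp.single_apply, ← h2]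
  refine Finset.sum_congr rfl fun k _ => ?_
  rw [← h1, Finset.sum_mul]
  exact Finset.sum_congr rfl fun l _ => by ring

/-- Contraction of the components of a bilinear map with those of a sum of tensors. -/
theorem sum_repr_smul_apply (b : Module.Basis κ ℝ V) (B : V →ₗ[ℝ] V →ₗ[ℝ] W) (m m' : ι → V) :
    ∑ i, ∑ j, (∑ k, b.repr (m k) i * b.repr (m' k) j) • B (b i) (b j) = ∑ k, B (m k) (m' k) := by
  have h : ∀ k, B (m k) (m' k) =
      ∑ i, ∑ j, (b.repr (m k) i * b.repr (m' k) j) • B (b i) (b j) := fun k => by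
    conv_lhs => rw [← b.sum_repr (m k), ← b.sum_repr (m' k)]
    rw [map_sum B, LinearMap.sum_apply]
    simp only [map_sum, map_smul, LinearMap.smul_apply, smul_smul, mul_comm]
  simp only [h, Finset.sum_smul]
  rw [Finset.sum_comm (s := (Finset.univ : Finset ι))]
  exact Finset.sum_congr rfl fun i _ => Finset.sum_comm

end Components

/-! ### Transfer of the Kähler and isometry conditions to a holomorphic chart. -/

section Manifold

variable {E : Type*} [NormedAddCommGroup E] [NormedSpace ℂ E]
  {M : Type*} [TopologicalSpace M] [ChartedSpace E M]

/-- Multiplication by `i` as a real linear map. -/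
def mulI (E : Type*) [NormedAddCommGroup E] [NormedSpace ℂ E] : E →L[ℝ] E :=
  (Complex.I • ContinuousLinearMap.id ℂ E).restrictScalars ℝ

theorem mulI_mulI (v : E) : mulI E (mulI E v) = -v := by
  simp [mulI, smul_smul]

/-- The differential of the inverse of the chart around `x`. -/
def chartSymmDeriv (x : M) (y : E) : E →L[ℝ] E :=
  mfderiv 𝓘(ℝ, E) 𝓘(ℝ, E) (extChartAt 𝓘(ℝ, E) x).symm y

theorem inChart_apply (B : ∀ x : M, TangentSpace 𝓘(ℝ, E) x →L[ℝ] TangentSpace 𝓘(ℝ, E) x →L[ℝ] ℝ)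
    (x : M) (y u v : E) :
    inChart B x y u v =
      B ((extChartAt 𝓘(ℝ, E) x).symm y) (chartSymmDeriv x y u) (chartSymmDeriv x y v) :=
  rfl

variable [IsManifold 𝓘(ℂ, E) ω M] {x : M} {y : E}

theorem chartSymmDeriv_isInvertible (hy : y ∈ (extChartAt 𝓘(ℝ, E) x).target) :
    (chartSymmDeriv x y).IsInvertible := by
  have h := isInvertible_mfderivWithin_extChartAt_symm (I := 𝓘(ℝ, E)) hy
  rw [modelWithCornersSelf_coe, Set.range_id, mfderivWithin_univ] at h
  exact h

theorem mdifferentiableAt_chart_symm (hy : y ∈ (extChartAt 𝓘(ℝ, E) x).target) :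
    MDifferentiableAt 𝓘(ℝ, E) 𝓘(ℝ, E) (extChartAt 𝓘(ℝ, E) x).symm y := by
  have h := mdifferentiableWithinAt_extChartAt_symm (I := 𝓘(ℝ, E)) hy
  rwa [modelWithCornersSelf_coe, Set.range_id, mdifferentiableWithinAt_univ] at h

/-- The chart is holomorphic, so its real differential is a complex linear map with scalars
restricted. This is what makes `J` constant in the chart. -/
theorem chartSymmDeriv_mulI (hy : y ∈ (extChartAt 𝓘(ℝ, E) x).target) (v : E) :
    chartSymmDeriv x y (mulI E v) = mulI E (chartSymmDeriv x y v) := by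
  have h := mdifferentiableWithinAt_extChartAt_symm (I := 𝓘(ℂ, E)) (x := x) (z := y) hy
  rw [modelWithCornersSelf_coe, Set.range_id, mdifferentiableWithinAt_univ] at h
  have h1 := h.hasMFDerivAt
  let D : E →L[ℂ] E := mfderiv 𝓘(ℂ, E) 𝓘(ℂ, E) (extChartAt 𝓘(ℂ, E) x).symm y
  have h2 : HasMFDerivAt 𝓘(ℝ, E) 𝓘(ℝ, E) (extChartAt 𝓘(ℝ, E) x).symm y
      (D.restrictScalars ℝ) := ⟨h1.1, h1.2.restrictScalars ℝ⟩
  have h3 : chartSymmDeriv x y = D.restrictScalars ℝ := h2.mfderiv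
  rw [h3]
  simp [mulI]

theorem mvfderiv_chartSymmDeriv {W : Type*} [NormedAddCommGroup W] [NormedSpace ℝ W] {F : M → W}
    (hy : y ∈ (extChartAt 𝓘(ℝ, E) x).target)
    (hF : MDifferentiableAt 𝓘(ℝ, E) 𝓘(ℝ, W) F ((extChartAt 𝓘(ℝ, E) x).symm y)) (v : E) :
    mvfderiv 𝓘(ℝ, E) F ((extChartAt 𝓘(ℝ, E) x).symm y) (chartSymmDeriv x y v) =
      fderiv ℝ (fun z => F ((extChartAt 𝓘(ℝ, E) x).symm z)) y v := by
  have h := mfderiv_comp y hF (mdifferentiableAt_chart_symm hy)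
  rw [mfderiv_eq_fderiv] at h
  exact congr($h v).symm

theorem contDiffAt_comp_chart_symm {W : Type*} [NormedAddCommGroup W] [NormedSpace ℝ W]
    {F : M → W} (hF : ContMDiff 𝓘(ℝ, E) 𝓘(ℝ, W) ∞ F)
    (hy : y ∈ (extChartAt 𝓘(ℝ, E) x).target) :
    ContDiffAt ℝ ∞ (fun z => F ((extChartAt 𝓘(ℝ, E) x).symm z)) y := by
  have h : ContMDiffOn 𝓘(ℝ, E) 𝓘(ℝ, W) ∞ (fun z => F ((extChartAt 𝓘(ℝ, E) x).symm z))
      (extChartAt 𝓘(ℝ, E) x).target := hF.comp_contMDiffOn (contMDiffOn_extChartAt_symm x)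
  exact (contMDiffOn_iff_contDiffOn.1 h).contDiffAt ((isOpen_extChartAt_target x).mem_nhds hy)

variable {g : Metric E M} {d : ℕ} {X : M → EuclideanSpace ℝ (Fin d)}

/-- The components of `X` in the chart around `x`. -/
def chartComponent (X : M → EuclideanSpace ℝ (Fin d)) (x : M) (k : Fin d) (y : E) : ℝ :=
  X ((extChartAt 𝓘(ℝ, E) x).symm y) k

theorem contDiffAt_chartComponent (hX : IsIsometricEmbedding g X)
    (hy : y ∈ (extChartAt 𝓘(ℝ, E) x).target) (k : Fin d) :
    ContDiffAt ℝ ∞ (chartComponent (E := E) X x k) y :=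
  (EuclideanSpace.proj (𝕜 := ℝ) k).contDiff.contDiffAt.comp y
    (contDiffAt_comp_chart_symm hX.smooth hy)

theorem inChart_inner (hX : IsIsometricEmbedding g X)
    (hy : y ∈ (extChartAt 𝓘(ℝ, E) x).target) (u v : E) :
    inChart g.inner x y u v = gram (chartComponent X x) y u v := by
  have hd := (contDiffAt_comp_chart_symm hX.smooth hy).differentiableAt (by simp)
  have hc : ∀ k w, fderiv ℝ (chartComponent (E := E) X x k) y w =
      fderiv ℝ (fun z => X ((extChartAt 𝓘(ℝ, E) x).symm z)) y w k := fun k w => by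
    have h := ((EuclideanSpace.proj (𝕜 := ℝ) k).hasFDerivAt.comp y hd.hasFDerivAt).fderiv
    exact congr($h w)
  have hm := (hX.smooth ((extChartAt 𝓘(ℝ, E) x).symm y)).mdifferentiableAt (by simp)
  refine (hX.isometric _ _ _).symm.trans ((congrArg₂ (inner ℝ) (mvfderiv_chartSymmDeriv hy hm u)
    (mvfderiv_chartSymmDeriv hy hm v)).trans ?_)
  rw [gram_apply, PiLp.inner_apply]
  simp only [hc]
  exact Finset.sum_congr rfl fun k _ => by simp [mul_comm]

theorem chartComponent_separates (hX : IsIsometricEmbedding g X)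
    (hy : y ∈ (extChartAt 𝓘(ℝ, E) x).target) (v : E)
    (hv : ∀ k, fderiv ℝ (chartComponent (E := E) X x k) y v = 0) : v = 0 := by
  by_contra hne
  have h := g.pos ((extChartAt 𝓘(ℝ, E) x).symm y) (chartSymmDeriv x y v) (fun h0 => hne <|
    (chartSymmDeriv_isInvertible hy).injective (h0.trans (map_zero _).symm))
  have h' := inChart_inner hX hy v v
  rw [inChart_apply] at h'
  rw [h', gram_apply] at h
  simp [hv] at h

theorem gram_mulI_skew (hg : IsKahler g) (hX : IsIsometricEmbedding g X)
    (hy : y ∈ (extChartAt 𝓘(ℝ, E) x).target) (u v : E) :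
    gram (chartComponent X x) y (mulI E u) v = -gram (chartComponent X x) y u (mulI E v) := by
  have h : gram (chartComponent X x) y (mulI E u) (mulI E (mulI E v)) =
      gram (chartComponent X x) y u (mulI E v) := by
    rw [← inChart_inner hX hy, ← inChart_inner hX hy, inChart_apply, inChart_apply,
      chartSymmDeriv_mulI hy, chartSymmDeriv_mulI hy (mulI E v)]
    exact hg.hermitian _ _ _
  rw [mulI_mulI, map_neg] at h
  rw [← h, neg_neg]

theorem inChart_fundamentalForm (hX : IsIsometricEmbedding g X)
    (hy : y ∈ (extChartAt 𝓘(ℝ, E) x).target) (u v : E) :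
    inChart (fundamentalForm g) x y u v = gram (chartComponent X x) y (mulI E u) v := by
  rw [← inChart_inner hX hy, inChart_apply, inChart_apply, chartSymmDeriv_mulI hy]
  rfl

theorem gramDeriv_closed (hg : IsKahler g) (hX : IsIsometricEmbedding g X) (x : M) (u v w : E) :
    gramDeriv (chartComponent X x) (extChartAt 𝓘(ℝ, E) x x) u (mulI E v) w +
      gramDeriv (chartComponent X x) (extChartAt 𝓘(ℝ, E) x x) v (mulI E w) u +
      gramDeriv (chartComponent X x) (extChartAt 𝓘(ℝ, E) x x) w (mulI E u) v = 0 := by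
  have hy := mem_extChartAt_target (I := 𝓘(ℝ, E)) x
  have h : ∀ a b, (fun y => inChart (fundamentalForm g) x y a b) =ᶠ[𝓝 (extChartAt 𝓘(ℝ, E) x x)]
      fun y => gram (chartComponent X x) y (mulI E a) b := fun a b =>
    Filter.mem_of_superset (extChartAt_target_mem_nhds x) fun z hz =>
      inChart_fundamentalForm hX hz a b
  have := hg.closed x u v w
  rwa [(h v w).fderiv_eq, (h w u).fderiv_eq, (h u v).fderiv_eq,
    fderiv_gram_apply fun k => contDiffAt_chartComponent hX hy k,
    fderiv_gram_apply fun k => contDiffAt_chartComponent hX hy k,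
    fderiv_gram_apply fun k => contDiffAt_chartComponent hX hy k] at this

end Manifold

/-! ### The Poisson bracket in the gradient frame. -/

section Bracket

variable {E : Type*} [NormedAddCommGroup E] [NormedSpace ℂ E] [FiniteDimensional ℂ E]
  {M : Type*} [TopologicalSpace M] [ChartedSpace E M] [IsManifold 𝓘(ℂ, E) ω M]
  {𝕜 : Type*} [RCLike 𝕜] {g : Metric E M} {d : ℕ} {X : M → EuclideanSpace ℝ (Fin d)}
  {x : M} {y : E}

theorem gram_gramGradient_apply (hX : IsIsometricEmbedding g X)
    (hy : y ∈ (extChartAt 𝓘(ℝ, E) x).target) (k : Fin d) (v : E) :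
    gram (chartComponent X x) y v (gramGradient (chartComponent X x) k y) =
      fderiv ℝ (chartComponent (E := E) X x k) y v := by
  have h := congr($(gram_gramGradient (chartComponent_separates hX hy) k) v)
  rw [← h, gram_apply, gram_apply]
  exact Finset.sum_congr rfl fun m _ => mul_comm _ _

theorem sum_gram_smul_gramGradient (hX : IsIsometricEmbedding g X)
    (hy : y ∈ (extChartAt 𝓘(ℝ, E) x).target) (v : E) :
    ∑ k, gram (chartComponent X x) y v (gramGradient (chartComponent X x) k y) •
      gramGradient (chartComponent X x) k y = v := by
  simp only [gram_gramGradient_apply hX hy]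
  refine sum_smul_gradient_eq
    (a := fun k => (fderiv ℝ (chartComponent (E := E) X x k) y : E →ₗ[ℝ] ℝ))
    (n := fun k => gramGradient (chartComponent X x) k y) (chartComponent_separates hX hy)
    (fun k w => ?_) v
  simpa [gram_apply] using congr($(gram_gramGradient (chartComponent_separates hX hy) k) w)

/-- The Poisson bivector at `p` in terms of a Parseval frame of the tangent space. -/
theorem poissonBracket_eq_sum_frame (p : M) {ι : Type*} [Fintype ι] (m : ι → E)
    (hm : ∀ v : E, ∑ k, (g.inner p v (m k) : ℝ) • m k = v) (f h : M → 𝕜) :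
    poissonBracket g f h p =
      -∑ k, mvfderiv 𝓘(ℝ, E) f p (mulI E (m k)) * mvfderiv 𝓘(ℝ, E) h p (m k) := by
  let B : E →L[ℝ] E →L[ℝ] ℝ := fundamentalForm g p
  let df : E →L[ℝ] 𝕜 := mvfderiv 𝓘(ℝ, E) f p
  let dh : E →L[ℝ] 𝕜 := mvfderiv 𝓘(ℝ, E) h p
  -- Parseval for `J v`, followed by `-J`: since `ω(v, m) = g(J v, m)`, the frame dual to `m k` for
  -- `ω` is `-J (m k)`.
  have hB : ∀ v, ∑ k, B v (m k) • (-mulI E (m k)) = v := fun v => by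
    have h1 := congr(mulI E $(hm (mulI E v)))
    rw [mulI_mulI, map_sum] at h1
    rw [← neg_inj, ← h1, ← Finset.sum_neg_distrib]
    exact Finset.sum_congr rfl fun k _ => by rw [smul_neg, neg_neg, map_smul]; rfl
  have h2 := gramMatrix_inv_eq (coordBasis E) B.toLinearMap₁₂ hB
  have h3 := sum_repr_smul_apply (coordBasis E)
    ((LinearMap.mul ℝ 𝕜).compl₁₂ (df : E →ₗ[ℝ] 𝕜) (dh : E →ₗ[ℝ] 𝕜)) (fun k => -mulI E (m k)) m
  have h4 : ∀ i j, poissonBivector g p i j =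
      ∑ k, (coordBasis E).repr (-mulI E (m k)) i * (coordBasis E).repr (m k) j := fun i j => by
    have h5 : poissonBivector g p i j = (Matrix.of fun i j => B.toLinearMap₁₂ (coordBasis E i)
      (coordBasis E j))⁻¹ j i := rfl
    rw [h5, h2, Matrix.of_apply]
    exact Finset.sum_congr rfl fun k _ => mul_comm _ _
  unfold poissonBracket
  simp only [h4]
  refine h3.trans ?_
  simp only [map_neg, LinearMap.compl₁₂_apply, LinearMap.neg_apply, Finset.sum_neg_distrib]
  rfl

/-- The bivector at a point `p` is written in the preferred chart at `p`, which varies with `p`. The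
frame formula allows any Parseval frame, here the gradients in the fixed chart around `x` carried
over by `chartSymmDeriv`. -/
theorem poissonBracket_comp_chart_symm (hX : IsIsometricEmbedding g X)
    (hy : y ∈ (extChartAt 𝓘(ℝ, E) x).target) {f h : M → 𝕜}
    (hf : MDifferentiableAt 𝓘(ℝ, E) 𝓘(ℝ, 𝕜) f ((extChartAt 𝓘(ℝ, E) x).symm y))
    (hh : MDifferentiableAt 𝓘(ℝ, E) 𝓘(ℝ, 𝕜) h ((extChartAt 𝓘(ℝ, E) x).symm y)) :
    poissonBracket g f h ((extChartAt 𝓘(ℝ, E) x).symm y) =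
      -∑ k, fderiv ℝ (fun z => f ((extChartAt 𝓘(ℝ, E) x).symm z)) y
          (mulI E (gramGradient (chartComponent X x) k y)) *
        fderiv ℝ (fun z => h ((extChartAt 𝓘(ℝ, E) x).symm z)) y
          (gramGradient (chartComponent X x) k y) := by
  have hm : ∀ v : E, ∑ k, (g.inner ((extChartAt 𝓘(ℝ, E) x).symm y) v
      (chartSymmDeriv x y (gramGradient (chartComponent X x) k y)) : ℝ) •
        chartSymmDeriv x y (gramGradient (chartComponent X x) k y) = v := fun v => by
    obtain ⟨w, rfl⟩ := (chartSymmDeriv_isInvertible hy).surjective v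
    conv_rhs => rw [← sum_gram_smul_gramGradient hX hy w]
    rw [map_sum]
    exact Finset.sum_congr rfl fun k _ => by
      rw [map_smul, ← inChart_inner hX hy, inChart_apply]
  rw [poissonBracket_eq_sum_frame _ _ hm]
  refine congrArg _ (Finset.sum_congr rfl fun k _ => ?_)
  rw [← chartSymmDeriv_mulI hy]
  exact congrArg₂ _ (mvfderiv_chartSymmDeriv hy hf _) (mvfderiv_chartSymmDeriv hy hh _)

/-- The Hamiltonian field of the component `X k` is `J (grad X k)`. -/
theorem poissonBracket_component (hg : IsKahler g) (hX : IsIsometricEmbedding g X)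
    (hy : y ∈ (extChartAt 𝓘(ℝ, E) x).target) (k : Fin d) {h : M → 𝕜}
    (hh : MDifferentiableAt 𝓘(ℝ, E) 𝓘(ℝ, 𝕜) h ((extChartAt 𝓘(ℝ, E) x).symm y)) :
    poissonBracket g (fun z => ((X z k : ℝ) : 𝕜)) h ((extChartAt 𝓘(ℝ, E) x).symm y) =
      fderiv ℝ (fun z => h ((extChartAt 𝓘(ℝ, E) x).symm z)) y
        (mulI E (gramGradient (chartComponent X x) k y)) := by
  have hs : ContMDiff 𝓘(ℝ, E) 𝓘(ℝ, 𝕜) ∞ fun z => ((X z k : ℝ) : 𝕜) :=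
    ((RCLike.ofRealCLM (K := 𝕜)).comp (EuclideanSpace.proj (𝕜 := ℝ) k)).contDiff.contMDiff.comp
      hX.smooth
  have hd : ∀ v, fderiv ℝ (fun z => ((X ((extChartAt 𝓘(ℝ, E) x).symm z) k : ℝ) : 𝕜)) y v =
      ((fderiv ℝ (chartComponent (E := E) X x k) y v : ℝ) : 𝕜) := fun v => by
    have h1 := ((RCLike.ofRealCLM (K := 𝕜)).hasFDerivAt.comp y
      ((contDiffAt_chartComponent hX hy k).differentiableAt (by simp)).hasFDerivAt).fderiv
    exact congr($h1 v)
  rw [poissonBracket_comp_chart_symm hX hy ((hs _).mdifferentiableAt (by simp)) hh]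
  conv_rhs => rw [← sum_gram_smul_gramGradient hX hy
    (mulI E (gramGradient (chartComponent X x) k y))]
  rw [map_sum, ← Finset.sum_neg_distrib]
  refine Finset.sum_congr rfl fun m _ => ?_
  -- With `n` the gradients, `-dξ k (J (n m)) = -g(J (n m), n k) = g(n m, J (n k))`: these are the
  -- Parseval coefficients of `J (n k)`.
  rw [hd, map_smul, RCLike.real_smul_eq_coe_mul, gram_mulI_skew hg hX hy, ← neg_mul,
    ← RCLike.ofReal_neg, ← gram_gramGradient_apply hX hy]
  congr 3
  rw [gram_apply, gram_apply]
  exact Finset.sum_congr rfl fun _ _ => mul_comm _ _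

theorem poissonBracket_component_component (hg : IsKahler g) (hX : IsIsometricEmbedding g X)
    (k : Fin d) {φ : M → 𝕜} (hφ : ContMDiff 𝓘(ℝ, E) 𝓘(ℝ, 𝕜) ∞ φ) (x : M) :
    poissonBracket g (fun z => ((X z k : ℝ) : 𝕜))
        (poissonBracket g (fun z => ((X z k : ℝ) : 𝕜)) φ) x =
      fderiv ℝ (fun y => fderiv ℝ (fun z => φ ((extChartAt 𝓘(ℝ, E) x).symm z)) y
          (mulI E (gramGradient (chartComponent X x) k y))) (extChartAt 𝓘(ℝ, E) x x)
        (mulI E (gramGradient (chartComponent X x) k (extChartAt 𝓘(ℝ, E) x x))) := by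
  set H : E → 𝕜 := fun y => fderiv ℝ (fun z => φ ((extChartAt 𝓘(ℝ, E) x).symm z)) y
    (mulI E (gramGradient (chartComponent X x) k y)) with hH
  set F : M → 𝕜 := poissonBracket g (fun z => ((X z k : ℝ) : 𝕜)) φ with hF
  have hy := mem_extChartAt_target (I := 𝓘(ℝ, E)) x
  have hx := extChartAt_to_inv (I := 𝓘(ℝ, E)) x
  have hFH : ∀ y ∈ (extChartAt 𝓘(ℝ, E) x).target, F ((extChartAt 𝓘(ℝ, E) x).symm y) = H y :=
    fun y hy => poissonBracket_component hg hX hy k ((hφ _).mdifferentiableAt (by simp))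
  have hHd : DifferentiableAt ℝ H (extChartAt 𝓘(ℝ, E) x x) :=
    (((contDiffAt_comp_chart_symm hφ hy).fderiv_right (m := ∞) (by simp)).differentiableAt
      (by simp)).clm_apply ((mulI E).differentiableAt.comp _ (differentiableAt_gramGradient
        (contDiffAt_chartComponent hX hy) (chartComponent_separates hX hy) k))
  -- The outer bracket differentiates `F`, whose differentiability is read off from its chart
  -- expression `H`.
  have hFd : MDifferentiableAt 𝓘(ℝ, E) 𝓘(ℝ, 𝕜) F x := by
    have h1 : MDifferentiableAt 𝓘(ℝ, E) 𝓘(ℝ, 𝕜) (H ∘ extChartAt 𝓘(ℝ, E) x) x :=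
      hHd.mdifferentiableAt.comp x (mdifferentiableAt_extChartAt (mem_chart_source E x))
    refine h1.congr_of_eventuallyEq (Filter.mem_of_superset
      (extChartAt_source_mem_nhds (I := 𝓘(ℝ, E)) x)
      fun z hz => ?_)
    have h2 := hFH _ ((extChartAt 𝓘(ℝ, E) x).map_source hz)
    rwa [(extChartAt 𝓘(ℝ, E) x).left_inv hz] at h2
  have h := poissonBracket_component hg hX hy k (h := F) (by rwa [hx])
  rw [hx] at h
  rw [h]
  congr 1
  exact Filter.EventuallyEq.fderiv_eq
    (Filter.mem_of_superset (extChartAt_target_mem_nhds x) fun z hz => hFH z hz)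

end Bracket

/-! ### The Laplacian in holomorphic coordinates. -/

section Laplacian

variable {E : Type*} [NormedAddCommGroup E] [NormedSpace ℂ E] [FiniteDimensional ℂ E]
  {M : Type*} [TopologicalSpace M] [ChartedSpace E M] [IsManifold 𝓘(ℂ, E) ω M]
  {𝕜 : Type*} [RCLike 𝕜] {g : Metric E M} {d : ℕ} {X : M → EuclideanSpace ℝ (Fin d)}

theorem metricMatrix_inv (hX : IsIsometricEmbedding g X) (x : M) {y : E}
    (hy : y ∈ (extChartAt 𝓘(ℝ, E) x).target) :
    (metricMatrix g x y)⁻¹ = Matrix.of fun i j =>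
      ∑ k, (coordBasis E).repr (gramGradient (chartComponent X x) k y) i *
        (coordBasis E).repr (gramGradient (chartComponent X x) k y) j := by
  rw [← gramMatrix_inv_eq (coordBasis E) (gram (chartComponent X x) y).toLinearMap₁₂
    (sum_gram_smul_gramGradient hX hy)]
  congr 1
  ext i j
  exact inChart_inner hX hy _ _

theorem fderiv_metricMatrix (hX : IsIsometricEmbedding g X) (x : M) (v : E)
    (i j : Fin (Module.finrank ℝ E)) :
    fderiv ℝ (fun z => metricMatrix g x z i j) (extChartAt 𝓘(ℝ, E) x x) v =
      gramDeriv (chartComponent X x) (extChartAt 𝓘(ℝ, E) x x) v (coordBasis E i)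
        (coordBasis E j) := by
  have h : (fun z => metricMatrix g x z i j) =ᶠ[𝓝 (extChartAt 𝓘(ℝ, E) x x)]
      fun z => gram (chartComponent X x) z (coordBasis E i) (coordBasis E j) :=
    Filter.mem_of_superset (extChartAt_target_mem_nhds x) fun z hz => inChart_inner hX hz _ _
  rw [h.fderiv_eq, fderiv_gram_apply (contDiffAt_chartComponent hX (mem_extChartAt_target x))]

/-- In holomorphic coordinates on a Kähler manifold, `∑ i j, g^{ij} Γ^l_{ij} = 0`. -/
theorem sum_metricMatrix_inv_mul_christoffel (hg : IsKahler g) (hX : IsIsometricEmbedding g X)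
    (x : M) (l : Fin (Module.finrank ℝ E)) :
    ∑ i, ∑ j, (metricMatrix g x (extChartAt 𝓘(ℝ, E) x x))⁻¹ i j *
      christoffel g x (extChartAt 𝓘(ℝ, E) x x) l i j = 0 := by
  have hy := mem_extChartAt_target (I := 𝓘(ℝ, E)) x
  set y := extChartAt 𝓘(ℝ, E) x x
  let T := gramDeriv (chartComponent (E := E) X x) y
  -- `S u` is twice the Christoffel symbol of the first kind with lowered index `u`. It is kept
  -- bilinear so that contraction with the inverse metric becomes a trace over the gradients.
  let S (u : E) : E →ₗ[ℝ] E →ₗ[ℝ] ℝ := T.compr₂ (LinearMap.applyₗ u) +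
    (T.compr₂ (LinearMap.applyₗ u)).flip - T u
  have h1 : ∀ u, ∑ i, ∑ j, (metricMatrix g x y)⁻¹ i j * S u (coordBasis E i) (coordBasis E j) = 0 :=
    fun u => by
      rw [metricMatrix_inv hX x hy]
      refine (sum_repr_smul_apply (coordBasis E) (S u)
        (fun k => gramGradient (chartComponent X x) k y)
        (fun k => gramGradient (chartComponent X x) k y)).trans ?_
      exact sum_christoffel_gramGradient_eq_zero (contDiffAt_chartComponent hX hy)
        (chartComponent_separates hX hy) mulI_mulI
        (Filter.mem_of_superset (extChartAt_target_mem_nhds x) fun z hz => gram_mulI_skew hg hX hz)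
        (gramDeriv_closed hg hX x) u
  have h2 : ∀ i j, christoffel g x y l i j = ∑ m, (1 / 2) * (metricMatrix g x y)⁻¹ l m *
      S (coordBasis E m) (coordBasis E i) (coordBasis E j) := fun i j => by
    unfold christoffel
    simp only [y, fderiv_metricMatrix hX]
    rw [Finset.mul_sum]
    exact Finset.sum_congr rfl fun m _ => mul_assoc _ _ _ |>.symm
  have h3 : ∀ i j, (metricMatrix g x y)⁻¹ i j * christoffel g x y l i j =
      ∑ m, (1 / 2) * (metricMatrix g x y)⁻¹ l m * ((metricMatrix g x y)⁻¹ i j *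
        S (coordBasis E m) (coordBasis E i) (coordBasis E j)) := fun i j => by
    rw [h2, Finset.mul_sum]
    exact Finset.sum_congr rfl fun m _ => by ring
  calc _ = ∑ m, (1 / 2) * (metricMatrix g x y)⁻¹ l m * ∑ i, ∑ j, (metricMatrix g x y)⁻¹ i j *
        S (coordBasis E m) (coordBasis E i) (coordBasis E j) := by
        simp only [h3, Finset.mul_sum]
        exact (Finset.sum_congr rfl fun _ _ => Finset.sum_comm).trans Finset.sum_comm
    _ = 0 := by simp only [h1, mul_zero, Finset.sum_const_zero]

theorem laplacian_eq_sum (hg : IsKahler g) (hX : IsIsometricEmbedding g X)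
    {φ : M → 𝕜} (hφ : ContMDiff 𝓘(ℝ, E) 𝓘(ℝ, 𝕜) ∞ φ) (x : M) :
    laplacian g φ x = -∑ k,
      fderiv ℝ (fderiv ℝ fun z => φ ((extChartAt 𝓘(ℝ, E) x).symm z)) (extChartAt 𝓘(ℝ, E) x x)
        (gramGradient (chartComponent X x) k (extChartAt 𝓘(ℝ, E) x x))
        (gramGradient (chartComponent X x) k (extChartAt 𝓘(ℝ, E) x x)) := by
  have hy := mem_extChartAt_target (I := 𝓘(ℝ, E)) x
  set y := extChartAt 𝓘(ℝ, E) x x with hyx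
  set Φ : E → 𝕜 := fun z => φ ((extChartAt 𝓘(ℝ, E) x).symm z) with hΦ
  have hd : DifferentiableAt ℝ (fderiv ℝ Φ) y :=
    ((contDiffAt_comp_chart_symm hφ hy).fderiv_right (m := ∞) (by simp)).differentiableAt (by simp)
  have h1 : ∀ i j, hessian g φ x i j = fderiv ℝ (fderiv ℝ Φ) y (coordBasis E i) (coordBasis E j) -
      ∑ k, christoffel g x y k i j • fderiv ℝ Φ y (coordBasis E k) := fun i j => by
    change fderiv ℝ (fun z => fderiv ℝ Φ z (coordBasis E j)) y (coordBasis E i) - _ = _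
    rw [fderiv_clm_apply hd (differentiableAt_const _)]
    simp [Φ, y]
  -- The connection term of the Hessian has zero trace.
  have h2 : ∑ i, ∑ j, (metricMatrix g x y)⁻¹ i j •
      ∑ k, christoffel g x y k i j • fderiv ℝ Φ y (coordBasis E k) = 0 := by
    have h3 : ∑ i, ∑ j, (metricMatrix g x y)⁻¹ i j •
        ∑ k, christoffel g x y k i j • fderiv ℝ Φ y (coordBasis E k) =
        ∑ k, (∑ i, ∑ j, (metricMatrix g x y)⁻¹ i j * christoffel g x y k i j) •
          fderiv ℝ Φ y (coordBasis E k) := by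
      simp only [Finset.smul_sum, Finset.sum_smul, smul_smul]
      exact (Finset.sum_congr rfl fun _ _ => Finset.sum_comm).trans Finset.sum_comm
    rw [h3]
    exact Finset.sum_eq_zero fun k _ => by
      rw [sum_metricMatrix_inv_mul_christoffel hg hX, zero_smul]
  unfold laplacian
  simp only [h1, smul_sub, Finset.sum_sub_distrib]
  rw [← hyx, h2, sub_zero, metricMatrix_inv hX x hy]
  exact congrArg _ (sum_repr_smul_apply (coordBasis E) (fderiv ℝ (fderiv ℝ Φ) y).toLinearMap₁₂
    (fun k => gramGradient (chartComponent X x) k y)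
    (fun k => gramGradient (chartComponent X x) k y))

end Laplacian

end KahlerLaplacian

end

theorem mainTheorem9 {𝕜 : Type*} [RCLike 𝕜]
    {E : Type*} [NormedAddCommGroup E] [NormedSpace ℂ E] [FiniteDimensional ℂ E]
    {M : Type*} [TopologicalSpace M] [T2Space M] [CompactSpace M] [ChartedSpace E M]
    [IsManifold 𝓘(ℂ, E) ω M]
    (g : KahlerLaplacian.Metric E M) (hg : KahlerLaplacian.IsKahler g)
    {d : ℕ} (X : M → EuclideanSpace ℝ (Fin d))
    (hX : KahlerLaplacian.IsIsometricEmbedding g X)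
    (φ : M → 𝕜) (hφ : ContMDiff 𝓘(ℝ, E) 𝓘(ℝ, 𝕜) ∞ φ) (x : M) :
    KahlerLaplacian.laplacian g φ x =
      -∑ k : Fin d, KahlerLaplacian.poissonBracket g (fun y => ((X y k : ℝ) : 𝕜))
        (KahlerLaplacian.poissonBracket g (fun y => ((X y k : ℝ) : 𝕜)) φ) x := by
  open KahlerLaplacian in
  have hy := mem_extChartAt_target (I := 𝓘(ℝ, E)) x
  have ht := extChartAt_target_mem_nhds (I := 𝓘(ℝ, E)) x
  rw [laplacian_eq_sum hg hX hφ, ← sum_fderiv_fderiv_gramGradient (J := mulI E)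
    (contDiffAt_comp_chart_symm hφ hy) (contDiffAt_chartComponent hX hy)
    (Filter.mem_of_superset ht fun z hz => chartComponent_separates hX hz) mulI_mulI
    (Filter.mem_of_superset ht fun z hz => gram_mulI_skew hg hX hz)]
  simp only [poissonBracket_component_component hg hX _ hφ]
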